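/- Let $m,N\ge 0$ be integers, $M=2^m$, and let $n_{i,k}\in\{0,1\}$ ($0\le k<m$) be the $k$-th binary digit of $i\in\{0,\dots,M-1\}$, $k=0$ being the least significant one; write $\bar u=1-u$. A constellation $[\mathbb X,\mathbb P]$ consists of an alphabet $\mathbb X=(\boldsymbol x_0,\dots,\boldsymbol x_{M-1})$ of vectors in $\mathbb R^N$ and a distribution of the form $P_i=\prod_{k=0}^{m-1}P_{C_k}(n_{i,k})$, where the independent bits $C_0,\dots,C_{m-1}$ satisfy $0<P_{C_k}(0)<1$ and $P_{C_k}(1)=1-P_{C_k}(0)$; the symbol $\boldsymbol X=\boldsymbol x_i$ is sent when $C_k=n_{i,k}$ for all $k$. The uniform distribution $\mathbb U_m$ is the case $P_{C_k}(0)=\tfrac12$ for all $k$. The channel is $\boldsymbol Y=\boldsymbol H\circ\boldsymbol X+\boldsymbol Z$, where $\circ$ is the element-wise product, $\boldsymbol Z$ is Gaussian with independent components of mean $0$ and variance $N_0/2$, $N_0>0$, and $\boldsymbol H$ is a random vector in $\mathbb R^N$ with (possibly dependent) identically distributed components, $0<\mathbb E[H^2]<\infty$; $\boldsymbol X,\boldsymbol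 H,\boldsymbol Z$ are independent. Let $I=\sum_{k=0}^{m-1}I(C_k;\boldsymbol Y|\boldsymbol H)$, in bits, with $I(C_k;\boldsymbol Y|\boldsymbol H)=\mathbb E\big[\log_2\frac{p(\boldsymbol Y|\boldsymbol H,C_k)}{p(\boldsymbol Y|\boldsymbol H)}\big]$, be the BICM generalized mutual information, regarded as a function $I(\mathrm{SNR})$ of $\mathrm{SNR}=\mathbb E[H^2]\,E_{\mathrm s}/N_0\ge 0$ by rescaling the alphabet for fixed $N_0$, fixed law of $\boldsymbol H$ and fixed $\mathbb P$. The low-GMI parameters of $[\mathbb X,\mathbb P]$ are $[\boldsymbol\mu,E_{\mathrm s},\alpha]$ with $$\boldsymbol\mu=\mathbb E[\boldsymbol X],\qquad E_{\mathrm s}=\mathbb E[\|\boldsymbol X\|^2],\qquad \alpha=\frac{d\,I(\mathrm{SNR})}{d\,\mathrm{SNR}}\Big|_{\mathrm{SNR}=0^+}$$ (if all $\boldsymbol x_i=\boldsymbol 0$, then $I(\mathrm{SNR})$ is read as $0$, so $\alpha=0$). The transform $\mathring{\mathbb X}$ of $\mathbb X$ is $$\mathring{\boldsymbol x}_i=\sum_{j=0}^{M-1}\gamma_{i,j}\sqrt{P_j}\,\boldsymbol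 x_j,\qquad \gamma_{i,j}=\prod_{k=0}^{m-1}\Big[(-1)^{\bar n_{i,k}n_{j,k}}\sqrt{P_{C_k}(0)}+(-1)^{n_{i,k}\bar n_{j,k}}\sqrt{P_{C_k}(1)}\Big].$$ Theorem. For every constellation $[\mathbb X,\mathbb P]$ as above, the derivatives defining $\alpha$ exist for $[\mathbb X,\mathbb P]$ and for $[\mathring{\mathbb X},\mathbb U_m]$, and the low-GMI parameters $[\boldsymbol\mu,E_{\mathrm s},\alpha]$ of $[\mathbb X,\mathbb P]$ are equal to those of $[\mathring{\mathbb X},\mathbb U_m]$ (for the same law of $\boldsymbol H$). -/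

import Mathlib

open MeasureTheory

namespace BICM

/-- The bit `n_{i,k}` of the natural binary code: binary digit number `k` of `i`, where digit `0` is
the least significant one. -/
def nbcBit {m : ℕ} (i : Fin (2 ^ m)) (k : Fin m) : Bool :=
  (i : ℕ).testBit (k : ℕ)

/-- The probability `P_{C_k}(u)` of bit number `k` being `u`, where `b k = P_{C_k}(0)`. -/
def bitProb {m : ℕ} (b : Fin m → ℝ) (k : Fin m) (u : Bool) : ℝ :=
  if u then 1 - b k else b k

/-- The product-form probability `P_i` of symbol number `i`, for the bit probabilities `b`. -/
def symbolProb {m : ℕ} (b : Fin m → ℝ) (i : Fin (2 ^ m)) : ℝ :=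
  ∏ k : Fin m, bitProb b k (nbcBit i k)

/-- Bit probabilities of the uniform distribution `U_m`. -/
noncomputable def uniformBits (m : ℕ) : Fin m → ℝ :=
  fun _ => 1 / 2

theorem symbolProb_uniformBits {m : ℕ} (i : Fin (2 ^ m)) :
    symbolProb (uniformBits m) i = 1 / (2 : ℝ) ^ m := by
  have h : ∀ k : Fin m, bitProb (uniformBits m) k (nbcBit i k) = 1 / 2 := by
    intro k
    unfold bitProb uniformBits
    split <;> norm_num
  simp [symbolProb, h]

/-- The coefficients `γ_{i,j}` of the transform. -/
noncomputable def gammaCoeff {m : ℕ} (b : Fin m → ℝ) (i j : Fin (2 ^ m)) : ℝ :=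
  ∏ k : Fin m,
    ((-1) ^ ((!nbcBit i k).toNat * (nbcBit j k).toNat) * √(bitProb b k false) +
      (-1) ^ ((nbcBit i k).toNat * (!nbcBit j k).toNat) * √(bitProb b k true))

/-- The transform of the alphabet `X` for the bit probabilities `b`. -/
noncomputable def newTransform {m N : ℕ} (b : Fin m → ℝ)
    (X : Fin (2 ^ m) → EuclideanSpace ℝ (Fin N)) : Fin (2 ^ m) → EuclideanSpace ℝ (Fin N) :=
  fun i => ∑ j, (gammaCoeff b i j * √(symbolProb b j)) • X j

/-- The mean `E[X]` of the channel input. -/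
noncomputable def mean {m N : ℕ} (b : Fin m → ℝ)
    (X : Fin (2 ^ m) → EuclideanSpace ℝ (Fin N)) : EuclideanSpace ℝ (Fin N) :=
  ∑ i, symbolProb b i • X i

/-- The average symbol energy `E[‖X‖²]` of the channel input. -/
noncomputable def energy {m N : ℕ} (b : Fin m → ℝ)
    (X : Fin (2 ^ m) → EuclideanSpace ℝ (Fin N)) : ℝ :=
  ∑ i, symbolProb b i * ‖X i‖ ^ 2

/-- The element-wise product of two vectors. -/
noncomputable def hadamardProd {N : ℕ} (h x : EuclideanSpace ℝ (Fin N)) :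
    EuclideanSpace ℝ (Fin N) :=
  WithLp.toLp 2 (fun n => h n * x n)

/-- The density `p(y | x, h)` of `Y = h ∘ x + Z`, where `Z` is Gaussian with independent
components of mean zero and variance `N₀ / 2`. -/
noncomputable def channelDensity {N : ℕ} (N₀ : ℝ) (h x y : EuclideanSpace ℝ (Fin N)) : ℝ :=
  1 / (N₀ * Real.pi) ^ ((N : ℝ) / 2) * Real.exp (-(‖y - hadamardProd h x‖ ^ 2 / N₀))

/-- The density `p(y | h)` of the channel output given the fading vector `h`. -/
noncomputable def outputDensity {m N : ℕ} (N₀ : ℝ) (b : Fin m → ℝ)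
    (X : Fin (2 ^ m) → EuclideanSpace ℝ (Fin N)) (h y : EuclideanSpace ℝ (Fin N)) : ℝ :=
  ∑ i, symbolProb b i * channelDensity N₀ h (X i) y

/-- The conditional probability of symbol number `i` given that bit number `k` is `u`. -/
noncomputable def condSymbolProb {m : ℕ} (b : Fin m → ℝ) (k : Fin m) (u : Bool)
    (i : Fin (2 ^ m)) : ℝ :=
  if nbcBit i k = u then symbolProb b i / bitProb b k u else 0

/-- The density `p(y | h, C_k = u)` of the channel output given the fading vector `h` and the
value `u` of bit number `k`. -/
noncomputable def condOutputDensity {m N : ℕ} (N₀ : ℝ) (b : Fin m → ℝ)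
    (X : Fin (2 ^ m) → EuclideanSpace ℝ (Fin N)) (k : Fin m) (u : Bool)
    (h y : EuclideanSpace ℝ (Fin N)) : ℝ :=
  ∑ i, condSymbolProb b k u i * channelDensity N₀ h (X i) y

/-- The mutual information `I(C_k; Y | H)` in bits, the expectation of
`log₂ (p(Y | H, C_k) / p(Y | H))`, where `ν` is the law of the fading vector `H`. -/
noncomputable def bitMutualInfo {m N : ℕ} (ν : Measure (EuclideanSpace ℝ (Fin N))) (N₀ : ℝ)
    (b : Fin m → ℝ) (X : Fin (2 ^ m) → EuclideanSpace ℝ (Fin N)) (k : Fin m) : ℝ :=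
  ∫ h, (∑ u : Bool, bitProb b k u *
    (∫ y, condOutputDensity N₀ b X k u h y *
      Real.logb 2 (condOutputDensity N₀ b X k u h y / outputDensity N₀ b X h y) ∂volume)) ∂ν

/-- The BICM generalized mutual information `∑ₖ I(C_k; Y | H)`. -/
noncomputable def gmi {m N : ℕ} (ν : Measure (EuclideanSpace ℝ (Fin N))) (N₀ : ℝ)
    (b : Fin m → ℝ) (X : Fin (2 ^ m) → EuclideanSpace ℝ (Fin N)) : ℝ :=
  ∑ k, bitMutualInfo ν N₀ b X k

/-- The second moment `E[H²]` of a fading coefficient with law `ρ`. -/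
noncomputable def secondMoment (ρ : Measure ℝ) : ℝ :=
  ∫ t, t ^ 2 ∂ρ

/-- The signal-to-noise ratio `E[H²] E_s / N₀`. -/
noncomputable def snr {m N : ℕ} (ρ : Measure ℝ) (N₀ : ℝ) (b : Fin m → ℝ)
    (X : Fin (2 ^ m) → EuclideanSpace ℝ (Fin N)) : ℝ :=
  secondMoment ρ * energy b X / N₀

/-- The BICM-GMI as a function of the signal-to-noise ratio `s ≥ 0`: the noise level `N₀` and the
bit probabilities are fixed, and the alphabet is rescaled so that the signal-to-noise ratio
becomes `s`. -/
noncomputable def gmiAtSNR {m N : ℕ} (ν : Measure (EuclideanSpace ℝ (Fin N))) (ρ : Measure ℝ)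
    (N₀ : ℝ) (b : Fin m → ℝ) (X : Fin (2 ^ m) → EuclideanSpace ℝ (Fin N)) (s : ℝ) : ℝ :=
  gmi ν N₀ b (fun i => √(s / snr ρ N₀ b X) • X i)

/-- The rescaled alphabet has signal-to-noise ratio `s`. -/
theorem snr_rescale {m N : ℕ} (ρ : Measure ℝ) (N₀ : ℝ) (b : Fin m → ℝ)
    (X : Fin (2 ^ m) → EuclideanSpace ℝ (Fin N)) (hX : 0 < snr ρ N₀ b X) {s : ℝ} (hs : 0 ≤ s) :
    snr ρ N₀ b (fun i => √(s / snr ρ N₀ b X) • X i) = s := by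
  have hE : energy b (fun i => √(s / snr ρ N₀ b X) • X i) = s / snr ρ N₀ b X * energy b X := by
    unfold energy
    rw [Finset.mul_sum]
    refine Finset.sum_congr rfl fun i _ => ?_
    rw [norm_smul, mul_pow, Real.norm_eq_abs, sq_abs, Real.sq_sqrt (div_nonneg hs hX.le)]
    ring
  calc snr ρ N₀ b (fun i => √(s / snr ρ N₀ b X) • X i)
      = s / snr ρ N₀ b X * snr ρ N₀ b X := by
        rw [snr, hE, snr]; ring
    _ = s := div_mul_cancel₀ s hX.ne'

/-- The slope of the BICM-GMI at zero signal-to-noise ratio (a one-sided derivative, as the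
signal-to-noise ratio is nonnegative). -/
noncomputable def alpha {m N : ℕ} (ν : Measure (EuclideanSpace ℝ (Fin N))) (ρ : Measure ℝ)
    (N₀ : ℝ) (b : Fin m → ℝ) (X : Fin (2 ^ m) → EuclideanSpace ℝ (Fin N)) : ℝ :=
  derivWithin (gmiAtSNR ν ρ N₀ b X) (Set.Ici 0) 0

/-- The low-GMI parameters `[μ, E_s, α]` of the constellation with alphabet `X` and bit
probabilities `b`. -/
noncomputable def lowGMIParameters {m N : ℕ} (ν : Measure (EuclideanSpace ℝ (Fin N)))
    (ρ : Measure ℝ) (N₀ : ℝ) (b : Fin m → ℝ) (X : Fin (2 ^ m) → EuclideanSpace ℝ (Fin N)) :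
    EuclideanSpace ℝ (Fin N) × ℝ × ℝ :=
  (mean b X, energy b X, alpha ν ρ N₀ b X)

end BICM

/-! ### Invariance of mean, energy and bit contrasts under the transform -/

namespace BICM

/-! At low SNR the information that bit k carries depends on the alphabet only through v_k =
√(P(0)P(1)) (E[X | C_k = 0] - E[X | C_k = 1]), which is `bitContrast`: when the alphabet is scaled
by ε, the k-th mutual information is ε² times a quadratic functional of v_k, `bitSlope`, up to
o(ε²). As SNR is proportional to ε², α is the sum of these functionals divided by the SNR of the
unscaled alphabet. It is therefore enough that the transform preserves the mean, the energy and
every v_k.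

For this, use the coordinates √P_j x_j. Each bit contributes the orthonormal basis e = (√P(0),
√P(1)), f = (√P(1), -√P(0)) of ℝ². The mean is the component along e ⊗ ... ⊗ e, v_k is the component
along the tensor with f in place k and e elsewhere, and the energy is the squared norm. The matrix γ
is a tensor product of 2 × 2 factors; divided by √2, each factor is the rotation taking e, f to the
corresponding basis for a uniform bit. Hence all these quantities are unchanged:
`sum_uniform_gammaCoeff`, `sum_uniform_gammaCoeff_mul`, `sum_contrastWeight_gammaCoeff`.

For the expansion, mutual information is an average of `klFun (p(y | u) / p(y))`, and `klFun x` is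
(x - 1)² / 2 to leading order at 1 (`tendsto_klFun_div_sq`). Passing to the limit takes two
dominated convergences: over y for fixed fading (`tendsto_integral_infoDensity`), and over the
fading (`tendsto_bitMutualInfo`), where a Hellinger bound quadratic in the centers makes finite
second moments sufficient. -/

theorem nbcBit_injective (m : ℕ) : Function.Injective (nbcBit (m := m)) := by
  intro i j h
  apply Fin.ext
  apply Nat.eq_of_testBit_eq
  intro k
  rcases lt_or_ge k m with hk | hk
  · exact congrFun h ⟨k, hk⟩
  · have hle : 2 ^ m ≤ 2 ^ k := Nat.pow_le_pow_right (by norm_num) hk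
    rw [Nat.testBit_lt_two_pow (i.2.trans_le hle), Nat.testBit_lt_two_pow (j.2.trans_le hle)]

theorem nbcBit_bijective (m : ℕ) : Function.Bijective (nbcBit (m := m)) :=
  (Fintype.bijective_iff_injective_and_card _).2 ⟨nbcBit_injective m, by simp⟩

/-- A sum over all symbols of a product over all bits is a product of sums over the bit values. -/
theorem sum_prod_nbcBit {m : ℕ} (f : Fin m → Bool → ℝ) :
    ∑ i : Fin (2 ^ m), ∏ k, f k (nbcBit i k) = ∏ k, (f k true + f k false) := by
  rw [Fintype.sum_bijective _ (nbcBit_bijective m) _ (fun x => ∏ k, f k (x k)) fun _ => rfl]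
  have := (Finset.prod_univ_sum (fun _ : Fin m => (Finset.univ : Finset Bool)) f).symm
  simpa only [Fintype.piFinset_univ, Fintype.sum_bool] using this

theorem bitProb_pos {m : ℕ} {b : Fin m → ℝ} (hb : ∀ k, 0 < b k ∧ b k < 1) (k : Fin m) (u : Bool) :
    0 < bitProb b k u := by
  cases u <;> simp [bitProb, hb k]

theorem symbolProb_pos {m : ℕ} {b : Fin m → ℝ} (hb : ∀ k, 0 < b k ∧ b k < 1) (i : Fin (2 ^ m)) :
    0 < symbolProb b i :=
  Finset.prod_pos fun k _ => bitProb_pos hb k _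

theorem uniformBits_mem {m : ℕ} (k : Fin m) : 0 < uniformBits m k ∧ uniformBits m k < 1 := by
  norm_num [uniformBits]

theorem bitProb_uniformBits {m : ℕ} (k : Fin m) (u : Bool) : bitProb (uniformBits m) k u = 1 / 2 := by
  cases u <;> norm_num [bitProb, uniformBits]

/-- Given one bit, the symbol distribution is still a product over the bits. -/
theorem condSymbolProb_eq_prod {m : ℕ} {b : Fin m → ℝ} (hb : ∀ k, 0 < b k ∧ b k < 1) (k : Fin m)
    (u : Bool) (i : Fin (2 ^ m)) :
    condSymbolProb b k u i =
      ∏ l, if l = k then (if nbcBit i l = u then 1 else 0) else bitProb b l (nbcBit i l) := by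
  rw [← Finset.mul_prod_erase _ _ (Finset.mem_univ k)]
  rw [condSymbolProb, symbolProb, ← Finset.mul_prod_erase _ _ (Finset.mem_univ k)]
  have h : ∏ l ∈ Finset.univ.erase k,
      (if l = k then (if nbcBit i l = u then (1 : ℝ) else 0) else bitProb b l (nbcBit i l)) =
      ∏ l ∈ Finset.univ.erase k, bitProb b l (nbcBit i l) :=
    Finset.prod_congr rfl fun l hl => if_neg (Finset.ne_of_mem_erase hl)
  rw [h, if_pos rfl]
  split_ifs with hu
  · rw [hu, mul_div_assoc, mul_div_left_comm, div_self (bitProb_pos hb k u).ne']; simp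
  · simp

theorem condSymbolProb_nonneg {m : ℕ} {b : Fin m → ℝ} (hb : ∀ k, 0 < b k ∧ b k < 1) (k : Fin m)
    (u : Bool) (i : Fin (2 ^ m)) : 0 ≤ condSymbolProb b k u i := by
  unfold condSymbolProb
  split_ifs
  · exact div_nonneg (symbolProb_pos hb i).le (bitProb_pos hb k u).le
  · exact le_rfl

theorem sum_condSymbolProb {m : ℕ} {b : Fin m → ℝ} (hb : ∀ k, 0 < b k ∧ b k < 1) (k : Fin m)
    (u : Bool) : ∑ i, condSymbolProb b k u i = 1 := by
  simp_rw [condSymbolProb_eq_prod hb]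
  refine (sum_prod_nbcBit fun l v => if l = k then (if v = u then 1 else 0) else bitProb b l v).trans ?_
  refine Finset.prod_eq_one fun l _ => ?_
  by_cases hl : l = k
  · cases u <;> simp [hl]
  · simp [hl, bitProb]

theorem symbolProb_eq_sum_condSymbolProb {m : ℕ} {b : Fin m → ℝ} (hb : ∀ k, 0 < b k ∧ b k < 1)
    (k : Fin m) (i : Fin (2 ^ m)) :
    symbolProb b i = ∑ u, bitProb b k u * condSymbolProb b k u i := by
  have h := bitProb_pos hb k (nbcBit i k)
  simp only [condSymbolProb, Fintype.sum_bool]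
  cases hn : nbcBit i k <;> rw [hn] at h <;> simp [mul_div_cancel₀, h.ne']

/-- The factor of `γ_{i,j}` belonging to one bit. -/
noncomputable def gammaFactor {m : ℕ} (b : Fin m → ℝ) (k : Fin m) (u v : Bool) : ℝ :=
  (-1) ^ ((!u).toNat * v.toNat) * √(bitProb b k false) +
    (-1) ^ (u.toNat * (!v).toNat) * √(bitProb b k true)

theorem sqrt_symbolProb {m : ℕ} {b : Fin m → ℝ} (hb : ∀ k, 0 < b k ∧ b k < 1) (i : Fin (2 ^ m)) :
    √(symbolProb b i) = ∏ k, √(bitProb b k (nbcBit i k)) := by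
  rw [symbolProb, Real.sqrt_eq_rpow, ← Real.finsetProd_rpow _ _ fun k _ => (bitProb_pos hb k _).le]
  simp_rw [Real.sqrt_eq_rpow]

/-- The summand is a product over k of functions of bit k of i alone, so the sum factorises. Per
bit, the column sums of the γ factor are 2√P(0) and 2√P(1): the rotation matches the two
e-directions. -/
theorem sum_uniform_gammaCoeff {m : ℕ} {b : Fin m → ℝ} (hb : ∀ k, 0 < b k ∧ b k < 1)
    (j : Fin (2 ^ m)) :
    ∑ i, symbolProb (uniformBits m) i * (gammaCoeff b i j * √(symbolProb b j)) =
      symbolProb b j := by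
  obtain ⟨f, f_def⟩ : ∃ f : Fin m → Bool → ℝ, f = fun k u =>
    1 / 2 * (gammaFactor b k u (nbcBit j k) * √(bitProb b k (nbcBit j k))) := ⟨_, rfl⟩
  have h : ∀ i, symbolProb (uniformBits m) i * (gammaCoeff b i j * √(symbolProb b j)) =
      ∏ k, f k (nbcBit i k) := by
    intro i
    rw [sqrt_symbolProb hb]
    simp only [f_def, symbolProb, gammaCoeff, bitProb_uniformBits, gammaFactor,
      ← Finset.prod_mul_distrib]
  simp_rw [h, sum_prod_nbcBit, f_def, symbolProb]
  refine Finset.prod_congr rfl fun k _ => ?_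
  have h0 := Real.mul_self_sqrt (bitProb_pos hb k false).le
  have h1 := Real.mul_self_sqrt (bitProb_pos hb k true).le
  cases nbcBit j k <;> simp [gammaFactor] <;> nlinarith

theorem mean_newTransform {m N : ℕ} {b : Fin m → ℝ} (hb : ∀ k, 0 < b k ∧ b k < 1)
    (X : Fin (2 ^ m) → EuclideanSpace ℝ (Fin N)) :
    mean (uniformBits m) (newTransform b X) = mean b X := by
  simp only [mean, newTransform, Finset.smul_sum, smul_smul]
  rw [Finset.sum_comm]
  simp_rw [← Finset.sum_smul, sum_uniform_gammaCoeff hb]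

/-- Bitwise, the columns of each 2 × 2 factor are orthogonal with squared norm 2(P(0) + P(1)) = 2.
Distinct symbols differ in some bit, whose factor then vanishes. The energy is preserved as a
consequence. -/
theorem sum_uniform_gammaCoeff_mul {m : ℕ} {b : Fin m → ℝ} (hb : ∀ k, 0 < b k ∧ b k < 1)
    (j l : Fin (2 ^ m)) :
    ∑ i, symbolProb (uniformBits m) i * (gammaCoeff b i j * gammaCoeff b i l) =
      if j = l then 1 else 0 := by
  obtain ⟨f, f_def⟩ : ∃ f : Fin m → Bool → ℝ, f = fun k u =>
    1 / 2 * (gammaFactor b k u (nbcBit j k) * gammaFactor b k u (nbcBit l k)) := ⟨_, rfl⟩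
  have h : ∀ i, symbolProb (uniformBits m) i * (gammaCoeff b i j * gammaCoeff b i l) =
      ∏ k, f k (nbcBit i k) := by
    intro i
    simp only [f_def, symbolProb, gammaCoeff, bitProb_uniformBits, gammaFactor,
      ← Finset.prod_mul_distrib]
  have hf : ∀ k u v, 1 / 2 * (gammaFactor b k true u * gammaFactor b k true v) +
      1 / 2 * (gammaFactor b k false u * gammaFactor b k false v) = if u = v then 1 else 0 := by
    intro k u v
    have h0 := Real.mul_self_sqrt (bitProb_pos hb k false).le
    have h1 := Real.mul_self_sqrt (bitProb_pos hb k true).le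
    have h2 : bitProb b k false + bitProb b k true = 1 := by simp [bitProb]
    cases u <;> cases v <;> simp [gammaFactor] <;> nlinarith
  simp_rw [h, sum_prod_nbcBit, f_def, hf]
  split_ifs with hjl
  · simp [hjl]
  · obtain ⟨k, hk⟩ := Function.ne_iff.1 ((nbcBit_injective m).ne hjl)
    exact Finset.prod_eq_zero (Finset.mem_univ k) (if_neg hk)

theorem energy_newTransform {m N : ℕ} {b : Fin m → ℝ} (hb : ∀ k, 0 < b k ∧ b k < 1)
    (X : Fin (2 ^ m) → EuclideanSpace ℝ (Fin N)) :
    energy (uniformBits m) (newTransform b X) = energy b X := by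
  have h : ∀ i, symbolProb (uniformBits m) i * ‖newTransform b X i‖ ^ 2 =
      ∑ j, ∑ l, symbolProb (uniformBits m) i * (gammaCoeff b i j * gammaCoeff b i l) *
        (√(symbolProb b j) * √(symbolProb b l) * inner ℝ (X j) (X l)) := by
    intro i
    rw [← real_inner_self_eq_norm_sq, newTransform, sum_inner, Finset.mul_sum]
    refine Finset.sum_congr rfl fun j _ => ?_
    rw [inner_sum, Finset.mul_sum]
    refine Finset.sum_congr rfl fun l _ => ?_
    rw [real_inner_smul_left, real_inner_smul_right]
    ring
  simp_rw [energy, h]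
  rw [Finset.sum_comm]
  refine Finset.sum_congr rfl fun j _ => ?_
  rw [Finset.sum_comm]
  simp_rw [← Finset.sum_mul, sum_uniform_gammaCoeff_mul hb]
  simp [Real.mul_self_sqrt (symbolProb_pos hb j).le]

/-- The scaled difference between the conditional means of the channel input given the two values
of bit number `k`. -/
noncomputable def bitContrast {m N : ℕ} (b : Fin m → ℝ)
    (X : Fin (2 ^ m) → EuclideanSpace ℝ (Fin N)) (k : Fin m) : EuclideanSpace ℝ (Fin N) :=
  ∑ i, (√(bitProb b k false * bitProb b k true) *
    (condSymbolProb b k false i - condSymbolProb b k true i)) • X i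

/-- Brings the weights of v_k into product form: bit k carries the sign ±√(P(0)P(1)), every other
bit its own probability. This lets the sum against γ factorise. -/
theorem contrastWeight_eq_prod {m : ℕ} {b : Fin m → ℝ} (hb : ∀ k, 0 < b k ∧ b k < 1) (k : Fin m)
    (i : Fin (2 ^ m)) :
    √(bitProb b k false * bitProb b k true) *
        (condSymbolProb b k false i - condSymbolProb b k true i) =
      ∏ l, if l = k then (if nbcBit i l then -1 else 1) * √(bitProb b l false * bitProb b l true)
        else bitProb b l (nbcBit i l) := by
  simp only [condSymbolProb_eq_prod hb]
  simp only [← Finset.mul_prod_erase _ _ (Finset.mem_univ k), if_true]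
  have h : ∀ c : Fin m → ℝ, ∏ l ∈ Finset.univ.erase k,
      (if l = k then c l else bitProb b l (nbcBit i l)) =
      ∏ l ∈ Finset.univ.erase k, bitProb b l (nbcBit i l) := fun c =>
    Finset.prod_congr rfl fun l hl => if_neg (Finset.ne_of_mem_erase hl)
  simp only [h]
  cases nbcBit i k <;> simp

/-- Bits other than k behave as for the mean. At bit k the half-difference of the two rows of the γ
factor is (√P(1), -√P(0)), the f-direction; multiplying by √P_j gives ±√(P(0)P(1)). -/
theorem sum_contrastWeight_gammaCoeff {m : ℕ} {b : Fin m → ℝ} (hb : ∀ k, 0 < b k ∧ b k < 1)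
    (k : Fin m) (j : Fin (2 ^ m)) :
    ∑ i, (√(bitProb (uniformBits m) k false * bitProb (uniformBits m) k true) *
        (condSymbolProb (uniformBits m) k false i - condSymbolProb (uniformBits m) k true i)) *
        (gammaCoeff b i j * √(symbolProb b j)) =
      √(bitProb b k false * bitProb b k true) *
        (condSymbolProb b k false j - condSymbolProb b k true j) := by
  have hs : √((1 : ℝ) / 2 * (1 / 2)) = 1 / 2 := Real.sqrt_mul_self (by norm_num)
  obtain ⟨f, f_def⟩ : ∃ f : Fin m → Bool → ℝ, f = fun l u =>
    (if l = k then (if u then -1 else 1) * (1 / 2) else 1 / 2) *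
      (gammaFactor b l u (nbcBit j l) * √(bitProb b l (nbcBit j l))) := ⟨_, rfl⟩
  have h : ∀ i, (√(bitProb (uniformBits m) k false * bitProb (uniformBits m) k true) *
        (condSymbolProb (uniformBits m) k false i - condSymbolProb (uniformBits m) k true i)) *
        (gammaCoeff b i j * √(symbolProb b j)) =
      ∏ l, f l (nbcBit i l) := by
    intro i
    rw [contrastWeight_eq_prod uniformBits_mem, sqrt_symbolProb hb]
    simp only [f_def, gammaCoeff, bitProb_uniformBits, gammaFactor, ← Finset.prod_mul_distrib, hs]
  simp_rw [h, sum_prod_nbcBit, f_def, contrastWeight_eq_prod hb]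
  refine Finset.prod_congr rfl fun l _ => ?_
  have h0 := Real.mul_self_sqrt (bitProb_pos hb l false).le
  have h1 := Real.mul_self_sqrt (bitProb_pos hb l true).le
  rw [Real.sqrt_mul (bitProb_pos hb l false).le]
  by_cases hl : l = k
  · cases nbcBit j l <;> simp [gammaFactor, hl] <;> ring
  · cases nbcBit j l <;> simp [gammaFactor, hl] <;> nlinarith

theorem bitContrast_newTransform {m N : ℕ} {b : Fin m → ℝ} (hb : ∀ k, 0 < b k ∧ b k < 1)
    (X : Fin (2 ^ m) → EuclideanSpace ℝ (Fin N)) (k : Fin m) :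
    bitContrast (uniformBits m) (newTransform b X) k = bitContrast b X k := by
  simp only [bitContrast, newTransform, Finset.smul_sum, smul_smul]
  rw [Finset.sum_comm]
  simp_rw [← Finset.sum_smul, sum_contrastWeight_gammaCoeff hb]

end BICM

/-! ### Second-order behaviour of the relative-entropy integrand -/

namespace BICM
open Filter Topology InformationTheory

/-- Follows from log x ≤ x - 1. Unlike the Taylor estimate it is valid for all x ≥ 0, so it can
serve for domination. -/
theorem klFun_le_sq {x : ℝ} (hx : 0 ≤ x) : klFun x ≤ (x - 1) ^ 2 := by
  rcases hx.eq_or_lt with rfl | hx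
  · simp [klFun]
  · have := mul_le_mul_of_nonneg_left (Real.log_le_sub_one_of_pos hx) hx.le
    rw [klFun]; nlinarith

/-- With t = 1 - x, the remainder of log(1 - t) after two terms is at most |t|³ / (1 - |t|) ≤ 2|t|³.
It is multiplied by |1 - t| ≤ 3/2, and a term t³/2 is left over, so 7/2 ≤ 4 suffices. -/
theorem abs_klFun_sub_le {x : ℝ} (hx : |x - 1| ≤ 1 / 2) :
    |klFun x - (x - 1) ^ 2 / 2| ≤ 4 * |x - 1| ^ 3 := by
  obtain ⟨t, rfl⟩ : ∃ t, x = 1 - t := ⟨1 - x, by ring⟩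
  have ht : |t| ≤ 1 / 2 := by simpa [abs_neg] using hx
  have h := Real.abs_log_sub_add_sum_range_le (x := t) (by linarith) 2
  simp only [Finset.sum_range_succ, Finset.sum_range_zero] at h
  norm_num at h
  have h2 : |t| ^ 3 / (1 - |t|) ≤ 2 * |t| ^ 3 := by
    rw [div_le_iff₀ (by linarith)]
    nlinarith [pow_nonneg (abs_nonneg t) 3]
  have key : klFun (1 - t) - (1 - t - 1) ^ 2 / 2 =
      (1 - t) * (t + t ^ 2 / 2 + Real.log (1 - t)) + t ^ 3 / 2 := by
    rw [klFun]; ring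
  have h3 : |1 - t| ≤ 3 / 2 := by
    rw [abs_le] at *; constructor <;> linarith
  rw [key]
  calc _ ≤ |(1 - t) * (t + t ^ 2 / 2 + Real.log (1 - t))| + |t ^ 3 / 2| := abs_add_le _ _
    _ ≤ 3 / 2 * (2 * |t| ^ 3) + |t| ^ 3 / 2 := by
      rw [abs_mul, abs_div, abs_pow]
      norm_num
      have := mul_le_mul h3 (h.trans h2) (abs_nonneg _) (by norm_num)
      linarith
    _ ≤ 4 * |1 - t - 1| ^ 3 := by
      have : |1 - t - 1| = |t| := by rw [show 1 - t - 1 = -t by ring, abs_neg]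
      rw [this]; nlinarith [pow_nonneg (abs_nonneg t) 3]

/-- Second-order behaviour of `klFun` along a curve through `1`. -/
theorem tendsto_klFun_div_sq {r : ℝ → ℝ} {d : ℝ} (hr : HasDerivAt r d 0) (h0 : r 0 = 1) :
    Tendsto (fun ε => klFun (r ε) / ε ^ 2) (𝓝[>] 0) (𝓝 (d ^ 2 / 2)) := by
  have hs : Tendsto (fun ε => (r ε - 1) / ε) (𝓝[>] 0) (𝓝 d) := by
    have := (hasDerivAt_iff_tendsto_slope_zero.1 hr).mono_left
      (nhdsWithin_mono 0 (fun x (hx : 0 < x) => hx.ne'))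
    refine this.congr fun ε => ?_
    simp [h0, div_eq_inv_mul]
  have hε : Tendsto (fun ε : ℝ => |ε|) (𝓝[>] 0) (𝓝 0) := by
    have : Tendsto (fun ε : ℝ => |ε|) (𝓝 0) (𝓝 |0|) := continuous_abs.tendsto 0
    rw [abs_zero] at this
    exact this.mono_left nhdsWithin_le_nhds
  have hb : Tendsto (fun ε => 4 * |(r ε - 1) / ε| ^ 3 * |ε|) (𝓝[>] 0) (𝓝 0) := by
    have := ((hs.abs.pow 3).const_mul 4).mul hε
    rwa [mul_zero] at this
  have hr1 : ∀ᶠ ε in 𝓝[>] (0 : ℝ), |r ε - 1| ≤ 1 / 2 := by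
    have : Tendsto (fun ε => |r ε - 1|) (𝓝 0) (𝓝 |r 0 - 1|) :=
      (hr.continuousAt.sub_const 1).abs
    rw [h0, sub_self, abs_zero] at this
    exact (this.mono_left nhdsWithin_le_nhds).eventually (eventually_le_nhds (by norm_num))
  have hdiff : Tendsto (fun ε => klFun (r ε) / ε ^ 2 - ((r ε - 1) / ε) ^ 2 / 2) (𝓝[>] 0)
      (𝓝 0) := by
    refine squeeze_zero_norm' ?_ hb
    filter_upwards [hr1, self_mem_nhdsWithin] with ε h1 (h2 : 0 < ε)
    have e1 : klFun (r ε) / ε ^ 2 - ((r ε - 1) / ε) ^ 2 / 2 =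
        (klFun (r ε) - (r ε - 1) ^ 2 / 2) / ε ^ 2 := by field_simp
    rw [e1, Real.norm_eq_abs, abs_div, abs_div, abs_of_pos h2, abs_of_pos (pow_pos h2 2),
      div_le_iff₀ (pow_pos h2 2)]
    refine (abs_klFun_sub_le h1).trans_eq ?_
    field_simp
  have := hdiff.add ((hs.pow 2).div_const 2)
  simpa using this

/-! ### Gaussian kernels and Hellinger distances -/

variable {N : ℕ}

/-- The unnormalized Gaussian density with center `a` and component variances `s / 2`. -/
noncomputable def gauss (s : ℝ) (a y : EuclideanSpace ℝ (Fin N)) : ℝ :=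
  Real.exp (-(‖y - a‖ ^ 2 / s))

theorem gauss_pos (s : ℝ) (a y : EuclideanSpace ℝ (Fin N)) : 0 < gauss s a y := Real.exp_pos _

/-- Makes `gauss (2 * s)` the square root of `gauss s`, so that the L² distance of two such roots is
an unnormalized Hellinger distance. -/
theorem gauss_eq_sq {s : ℝ} (a y : EuclideanSpace ℝ (Fin N)) :
    gauss s a y = gauss (2 * s) a y ^ 2 := by
  rw [gauss, gauss, ← Real.exp_nat_mul]
  congr 1
  by_cases h : s = 0
  · simp [h]
  · push_cast; field_simp

theorem integrable_gauss_zero {s : ℝ} (hs : 0 < s) :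
    Integrable (gauss s (0 : EuclideanSpace ℝ (Fin N))) := by
  have h := GaussianFourier.integrable_cexp_neg_mul_sq_norm_add (V := EuclideanSpace ℝ (Fin N))
    (b := ((1 / s : ℝ) : ℂ)) (by simpa using hs) 0 0
  refine h.norm.congr (Eventually.of_forall fun y => ?_)
  simp only [Complex.norm_exp, gauss]
  congr 1
  simp only [zero_mul, add_zero, sub_zero]
  rw [← Complex.ofReal_pow, ← Complex.ofReal_neg, ← Complex.ofReal_mul, Complex.ofReal_re]
  ring

theorem gauss_eq_gauss_zero (s : ℝ) (a y : EuclideanSpace ℝ (Fin N)) :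
    gauss s a y = gauss s 0 (y - a) := by simp [gauss]

theorem integrable_gauss {s : ℝ} (hs : 0 < s) (a : EuclideanSpace ℝ (Fin N)) :
    Integrable (gauss s a) := by
  have := (integrable_gauss_zero (N := N) hs).comp_sub_right a
  exact this.congr (Eventually.of_forall fun y => (gauss_eq_gauss_zero s a y).symm)

theorem integral_gauss (s : ℝ) (a : EuclideanSpace ℝ (Fin N)) :
    ∫ y, gauss s a y = ∫ y, gauss s (0 : EuclideanSpace ℝ (Fin N)) y := by
  simp_rw [gauss_eq_gauss_zero s a]
  exact integral_sub_right_eq_self (gauss s (0 : EuclideanSpace ℝ (Fin N))) a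

/-- By the parallelogram law the product of two root densities is a Gaussian at the midpoint, damped
by the distance of the centers; its integral is the Hellinger affinity. -/
theorem gauss_mul_gauss {s : ℝ} (hs : 0 < s) (a c y : EuclideanSpace ℝ (Fin N)) :
    gauss (2 * s) a y * gauss (2 * s) c y =
      Real.exp (-(‖a - c‖ ^ 2 / (4 * s))) * gauss s ((1 / 2 : ℝ) • (a + c)) y := by
  simp only [gauss]
  rw [← Real.exp_add, ← Real.exp_add]
  congr 1
  have h := parallelogram_law_with_norm ℝ (y - a) (y - c)
  have e1 : y - a + (y - c) = (2 : ℝ) • (y - (1 / 2 : ℝ) • (a + c)) := by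
    rw [smul_sub, smul_smul]; norm_num; rw [two_smul]; abel
  have e2 : y - a - (y - c) = -(a - c) := by abel
  rw [e1, e2, norm_smul, norm_neg, Real.norm_of_nonneg (by norm_num)] at h
  field_simp
  linarith

theorem integrable_sq_gauss_sub {s : ℝ} (hs : 0 < s) (a c : EuclideanSpace ℝ (Fin N)) :
    Integrable fun y => (gauss (2 * s) a y - gauss (2 * s) c y) ^ 2 := by
  have h : (fun y => (gauss (2 * s) a y - gauss (2 * s) c y) ^ 2) = fun y =>
      gauss s a y + gauss s c y - 2 * (Real.exp (-(‖a - c‖ ^ 2 / (4 * s))) *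
        gauss s ((1 / 2 : ℝ) • (a + c)) y) := by
    funext y
    rw [← gauss_mul_gauss hs, gauss_eq_sq (s := s) a, gauss_eq_sq (s := s) c]; ring
  rw [h]
  exact ((integrable_gauss hs a).add (integrable_gauss hs c)).sub
    (((integrable_gauss hs _).const_mul _).const_mul _)

/-- The squared Hellinger distance of two Gaussians is at most quadratic in the distance of their
centers. -/
theorem integral_sq_gauss_sub_le {s : ℝ} (hs : 0 < s) (a c : EuclideanSpace ℝ (Fin N)) :
    ∫ y, (gauss (2 * s) a y - gauss (2 * s) c y) ^ 2 ≤
      (∫ y, gauss s (0 : EuclideanSpace ℝ (Fin N)) y) / (2 * s) * ‖a - c‖ ^ 2 := by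
  have h : (fun y => (gauss (2 * s) a y - gauss (2 * s) c y) ^ 2) = fun y =>
      gauss s a y + gauss s c y - 2 * (Real.exp (-(‖a - c‖ ^ 2 / (4 * s))) *
        gauss s ((1 / 2 : ℝ) • (a + c)) y) := by
    funext y
    rw [← gauss_mul_gauss hs, gauss_eq_sq (s := s) a, gauss_eq_sq (s := s) c]; ring
  have hac : Integrable fun y => gauss s a y + gauss s c y :=
    (integrable_gauss hs a).add (integrable_gauss hs c)
  rw [h, integral_sub hac (((integrable_gauss hs _).const_mul _).const_mul _), integral_const_mul, integral_const_mul,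
    integral_add (integrable_gauss hs a) (integrable_gauss hs c)]
  simp only [integral_gauss s a, integral_gauss s c, integral_gauss s ((1 / 2 : ℝ) • (a + c))]
  have hG : 0 ≤ ∫ y, gauss s (0 : EuclideanSpace ℝ (Fin N)) y :=
    integral_nonneg fun y => (gauss_pos s 0 y).le
  generalize ∫ y, gauss s (0 : EuclideanSpace ℝ (Fin N)) y = G at hG ⊢
  -- The integral is 2G(1 - exp(-t)) with t = ‖a - c‖² / (4s), and 1 - exp(-t) ≤ t.
  have he := Real.add_one_le_exp (-(‖a - c‖ ^ 2 / (4 * s)))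
  calc _ = 2 * G * (1 - Real.exp (-(‖a - c‖ ^ 2 / (4 * s)))) := by ring
    _ ≤ 2 * G * (‖a - c‖ ^ 2 / (4 * s)) := by gcongr; linarith
    _ = _ := by ring

theorem abs_exp_neg_sub_le (x z : ℝ) :
    |Real.exp (-x) - Real.exp (-z)| ≤ |x - z| * (Real.exp (-x) + Real.exp (-z)) := by
  wlog h : x ≤ z generalizing x z
  · rw [abs_sub_comm, abs_sub_comm x, add_comm]; exact this z x (le_of_not_ge h)
  have h1 : Real.exp (-z) ≤ Real.exp (-x) := Real.exp_le_exp.2 (by linarith)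
  rw [abs_of_nonneg (by linarith), abs_of_nonpos (by linarith)]
  have h2 := Real.add_one_le_exp (-(z - x))
  have h3 : Real.exp (-z) = Real.exp (-x) * Real.exp (-(z - x)) := by
    rw [← Real.exp_add]; congr 1; ring
  have h4 : (1 - Real.exp (-(z - x))) ≤ z - x := by linarith
  have h5 := mul_le_mul_of_nonneg_left h4 (Real.exp_pos (-x)).le
  have h6 := mul_nonneg (sub_nonneg.2 h) (Real.exp_pos (-z)).le
  nlinarith

/-- Moving the center to 0 uses ‖y‖² ≤ 2‖y - εa‖² + 2‖a‖², which is why the width parameter doubles.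
-/
theorem gauss_smul_le {s : ℝ} (hs : 0 < s) {ε : ℝ} (hε : 0 ≤ ε) (hε1 : ε ≤ 1)
    (a y : EuclideanSpace ℝ (Fin N)) :
    gauss (2 * s) (ε • a) y ≤ Real.exp (‖a‖ ^ 2 / (2 * s)) * gauss (4 * s) 0 y := by
  rw [gauss, gauss, ← Real.exp_add]
  refine Real.exp_le_exp.2 ?_
  have h1 : ‖ε • a‖ ≤ ‖a‖ := by
    rw [norm_smul, Real.norm_of_nonneg hε]
    exact mul_le_of_le_one_left (norm_nonneg a) hε1
  have h2 : ‖y‖ ≤ ‖y - ε • a‖ + ‖a‖ := by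
    have := norm_add_le (y - ε • a) (ε • a)
    rw [sub_add_cancel] at this
    linarith
  have h3 : ‖y‖ ^ 2 ≤ 2 * ‖y - ε • a‖ ^ 2 + 2 * ‖a‖ ^ 2 := by
    nlinarith [norm_nonneg y, sq_nonneg (‖y - ε • a‖ - ‖a‖), norm_nonneg a,
      norm_nonneg (y - ε • a)]
  rw [sub_zero]
  field_simp
  linarith

/-- The majorant, free of ε, for dominated convergence in y. The exponents differ by at most ε(A‖y‖
+ B), and both Gaussians together are at most E g with g = `gauss (4 * s) 0 y`. Of the resulting g²,
one factor absorbs the polynomial (A‖y‖ + B)² and the other remains. -/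
theorem exists_bound_sq_gauss_smul_sub {s : ℝ} (hs : 0 < s) (a c : EuclideanSpace ℝ (Fin N)) :
    ∃ C : ℝ, ∀ ε : ℝ, 0 < ε → ε ≤ 1 → ∀ y,
      (gauss (2 * s) (ε • a) y - gauss (2 * s) (ε • c) y) ^ 2 / ε ^ 2 ≤ C * gauss (4 * s) 0 y := by
  set E : ℝ := Real.exp (‖a‖ ^ 2 / (2 * s)) + Real.exp (‖c‖ ^ 2 / (2 * s))
  set A : ℝ := ‖a - c‖ / s
  set B : ℝ := (‖a‖ ^ 2 + ‖c‖ ^ 2) / (2 * s)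
  refine ⟨(2 * A ^ 2 * (4 * s) + 2 * B ^ 2) * E ^ 2, fun ε hε hε1 y => ?_⟩
  have hE : 0 < E := by positivity
  have hB : 0 ≤ B := by positivity
  have hA : 0 ≤ A := by positivity
  set g := gauss (4 * s) 0 y
  have hg : 0 < g := gauss_pos _ _ _
  have e1 : |‖y - ε • a‖ ^ 2 / (2 * s) - ‖y - ε • c‖ ^ 2 / (2 * s)| ≤ ε * (A * ‖y‖ + B) := by
    have e2 : ‖y - ε • a‖ ^ 2 / (2 * s) - ‖y - ε • c‖ ^ 2 / (2 * s) =
        ε * (-(inner ℝ y (a - c) / s) + ε * (‖a‖ ^ 2 - ‖c‖ ^ 2) / (2 * s)) := by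
      rw [norm_sub_sq_real, norm_sub_sq_real, inner_smul_right, inner_smul_right, inner_sub_right,
        norm_smul, norm_smul, mul_pow, mul_pow, Real.norm_eq_abs, sq_abs]
      field_simp
      ring
    rw [e2, abs_mul, abs_of_pos hε]
    gcongr
    refine (abs_add_le _ _).trans (add_le_add ?_ ?_)
    · rw [abs_neg, abs_div, abs_of_pos hs, div_mul_eq_mul_div, mul_comm ‖a - c‖]
      exact div_le_div_of_nonneg_right (abs_real_inner_le_norm _ _) hs.le
    · rw [abs_div, abs_mul, abs_of_pos hε, abs_of_pos (by positivity : 0 < 2 * s)]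
      refine div_le_div_of_nonneg_right ?_ (by positivity)
      have : |‖a‖ ^ 2 - ‖c‖ ^ 2| ≤ ‖a‖ ^ 2 + ‖c‖ ^ 2 := by
        rw [abs_le]; constructor <;> nlinarith [sq_nonneg ‖a‖, sq_nonneg ‖c‖]
      calc ε * |‖a‖ ^ 2 - ‖c‖ ^ 2| ≤ 1 * (‖a‖ ^ 2 + ‖c‖ ^ 2) := by gcongr
        _ = _ := one_mul _
  have e3 : |gauss (2 * s) (ε • a) y - gauss (2 * s) (ε • c) y| ≤
      ε * ((A * ‖y‖ + B) * (E * g)) := by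
    refine (abs_exp_neg_sub_le _ _).trans ?_
    rw [← mul_assoc]
    refine mul_le_mul e1 ?_ (by positivity) (by positivity)
    have := add_le_add (gauss_smul_le hs hε.le hε1 a y) (gauss_smul_le hs hε.le hε1 c y)
    rwa [← add_mul] at this
  have e4 : (gauss (2 * s) (ε • a) y - gauss (2 * s) (ε • c) y) ^ 2 / ε ^ 2 ≤
      ((A * ‖y‖ + B) * (E * g)) ^ 2 := by
    rw [div_le_iff₀ (by positivity), ← sq_abs, ← mul_pow, mul_comm _ ε]
    gcongr
  refine e4.trans ?_
  have e5 : ‖y‖ ^ 2 * g ≤ 4 * s := by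
    have h := Real.add_one_le_exp (‖y‖ ^ 2 / (4 * s))
    have hg' : g = (Real.exp (‖y‖ ^ 2 / (4 * s)))⁻¹ := by
      simp only [g, gauss, sub_zero, Real.exp_neg]
    rw [hg', mul_inv_le_iff₀ (Real.exp_pos _)]
    have h' : ‖y‖ ^ 2 / (4 * s) ≤ Real.exp (‖y‖ ^ 2 / (4 * s)) := by linarith
    rwa [div_le_iff₀ (by positivity), mul_comm] at h'
  have e6 : g ≤ 1 := by
    simp only [g, gauss]
    exact Real.exp_le_one_iff.2 (by simp; positivity)
  have e7 : (A * ‖y‖ + B) ^ 2 * g ≤ 2 * A ^ 2 * (4 * s) + 2 * B ^ 2 := by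
    have h1 : (A * ‖y‖ + B) ^ 2 ≤ 2 * A ^ 2 * ‖y‖ ^ 2 + 2 * B ^ 2 := by
      nlinarith [sq_nonneg (A * ‖y‖ - B)]
    calc _ ≤ (2 * A ^ 2 * ‖y‖ ^ 2 + 2 * B ^ 2) * g := by gcongr
      _ = 2 * A ^ 2 * (‖y‖ ^ 2 * g) + 2 * B ^ 2 * g := by ring
      _ ≤ 2 * A ^ 2 * (4 * s) + 2 * B ^ 2 * 1 := by gcongr
      _ = _ := by ring
  calc _ = ((A * ‖y‖ + B) ^ 2 * g) * (E ^ 2 * g) := by ring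
    _ ≤ (2 * A ^ 2 * (4 * s) + 2 * B ^ 2) * (E ^ 2 * g) := by gcongr
    _ = _ := by ring

theorem hasDerivAt_gauss_smul (s : ℝ) (a y : EuclideanSpace ℝ (Fin N)) :
    HasDerivAt (fun ε : ℝ => gauss s (ε • a) y) (gauss s 0 y * (2 / s * inner ℝ y a)) 0 := by
  have h : (fun ε : ℝ => gauss s (ε • a) y) = fun ε : ℝ =>
      Real.exp (-((‖y‖ ^ 2 - 2 * (ε * inner ℝ y a) + ε ^ 2 * ‖a‖ ^ 2) / s)) := by
    funext ε
    rw [gauss, norm_sub_sq_real, inner_smul_right, norm_smul, mul_pow, Real.norm_eq_abs, sq_abs]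
  rw [h]
  have h1 : HasDerivAt (fun ε : ℝ => ‖y‖ ^ 2 - 2 * (ε * inner ℝ y a) + ε ^ 2 * ‖a‖ ^ 2)
      (-(2 * inner ℝ y a)) 0 := by
    have ha := (((hasDerivAt_id (0 : ℝ)).mul_const (inner ℝ y a)).const_mul 2).const_sub (‖y‖ ^ 2)
    have hb := ((hasDerivAt_id (0 : ℝ)).pow 2).mul_const (‖a‖ ^ 2)
    refine (ha.add hb).congr_deriv ?_
    simp
  refine (h1.div_const s).neg.exp.congr_deriv ?_
  simp [gauss]
  ring

end BICM

/-! ### Low-signal information of a binary mixture of Gaussians -/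

namespace BICM
open Filter Topology InformationTheory

variable {N : ℕ} {ι : Type*} [Fintype ι]

/-- The positive distribution `w` is the mixture of the two distributions `c u` with positive
weights `q u`. -/
structure IsBinaryMixture (q : Bool → ℝ) (c : Bool → ι → ℝ) (w : ι → ℝ) : Prop where
  weight_pos : ∀ u, 0 < q u
  weight_sum : ∑ u, q u = 1
  cond_nonneg : ∀ u i, 0 ≤ c u i
  cond_sum : ∀ u, ∑ i, c u i = 1
  eq_sum : ∀ i, w i = ∑ u, q u * c u i
  pos : ∀ i, 0 < w i

/-- The unnormalized Gaussian mixture with weights `w` and centers `a`. -/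
noncomputable def gaussMix (s : ℝ) (w : ι → ℝ) (a : ι → EuclideanSpace ℝ (Fin N))
    (y : EuclideanSpace ℝ (Fin N)) : ℝ :=
  ∑ i, w i * gauss s (a i) y

/-- The pointwise contribution of the output `y` to the mutual information (in nats) between the
mixing bit and the output. -/
noncomputable def infoDensity (s : ℝ) (q : Bool → ℝ) (c : Bool → ι → ℝ) (w : ι → ℝ)
    (a : ι → EuclideanSpace ℝ (Fin N)) (y : EuclideanSpace ℝ (Fin N)) : ℝ :=
  ∑ u, q u * (gaussMix s (c u) a y * Real.log (gaussMix s (c u) a y / gaussMix s w a y))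

variable {q : Bool → ℝ} {c : Bool → ι → ℝ} {w : ι → ℝ}

namespace IsBinaryMixture

theorem sum_eq_one (h : IsBinaryMixture q c w) : ∑ i, w i = 1 := by
  simp_rw [h.eq_sum]
  rw [Finset.sum_comm]
  simp_rw [← Finset.mul_sum, h.cond_sum, mul_one, h.weight_sum]

theorem mul_cond_le (h : IsBinaryMixture q c w) (u : Bool) (i : ι) : q u * c u i ≤ w i := by
  rw [h.eq_sum]
  exact Finset.single_le_sum (f := fun u => q u * c u i)
    (fun v _ => mul_nonneg (h.weight_pos v).le (h.cond_nonneg v i)) (Finset.mem_univ u)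

theorem gaussMix_pos (h : IsBinaryMixture q c w) (s : ℝ) (a : ι → EuclideanSpace ℝ (Fin N))
    (y : EuclideanSpace ℝ (Fin N)) : 0 < gaussMix s w a y := by
  have hne : (Finset.univ : Finset ι).Nonempty := by
    by_contra hemp
    have := h.sum_eq_one
    rw [Finset.not_nonempty_iff_eq_empty.1 hemp] at this
    simp at this
  exact Finset.sum_pos (fun i _ => mul_pos (h.pos i) (gauss_pos _ _ _)) hne

theorem gaussMix_cond_nonneg (h : IsBinaryMixture q c w) (s : ℝ) (u : Bool)
    (a : ι → EuclideanSpace ℝ (Fin N)) (y : EuclideanSpace ℝ (Fin N)) :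
    0 ≤ gaussMix s (c u) a y :=
  Finset.sum_nonneg fun i _ => mul_nonneg (h.cond_nonneg u i) (gauss_pos _ _ _).le

theorem gaussMix_eq_sum (h : IsBinaryMixture q c w) (s : ℝ) (a : ι → EuclideanSpace ℝ (Fin N))
    (y : EuclideanSpace ℝ (Fin N)) : gaussMix s w a y = ∑ u, q u * gaussMix s (c u) a y := by
  simp only [gaussMix, Finset.mul_sum]
  rw [Finset.sum_comm]
  refine Finset.sum_congr rfl fun i _ => ?_
  rw [h.eq_sum i, Finset.sum_mul]
  simp_rw [mul_assoc]

/-- The terms 1 - x by which `klFun x` differs from x log x average to zero, because the total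
mixture is the q-average of the conditional ones. The new form has nonnegative terms that vanish to
second order. -/
theorem infoDensity_eq (h : IsBinaryMixture q c w) (s : ℝ) (a : ι → EuclideanSpace ℝ (Fin N))
    (y : EuclideanSpace ℝ (Fin N)) :
    infoDensity s q c w a y =
      gaussMix s w a y * ∑ u, q u * klFun (gaussMix s (c u) a y / gaussMix s w a y) := by
  have hM := (h.gaussMix_pos s a y).ne'
  have h1 := h.gaussMix_eq_sum s a y
  have h2 := h.weight_sum
  simp only [infoDensity, klFun, Fintype.sum_bool] at *
  generalize gaussMix s w a y = M at *
  generalize gaussMix s (c true) a y = A at *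
  generalize gaussMix s (c false) a y = B at *
  have e : M * (q true * (A / M * Real.log (A / M) + 1 - A / M) +
      q false * (B / M * Real.log (B / M) + 1 - B / M)) =
      q true * (A * Real.log (A / M)) + q false * (B * Real.log (B / M)) +
      (M * (q true + q false) - (q true * A + q false * B)) := by
    field_simp
    ring
  rw [e, h2, ← h1]
  ring

theorem infoDensity_nonneg (h : IsBinaryMixture q c w) (s : ℝ)
    (a : ι → EuclideanSpace ℝ (Fin N)) (y : EuclideanSpace ℝ (Fin N)) :
    0 ≤ infoDensity s q c w a y := by
  rw [h.infoDensity_eq]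
  refine mul_nonneg (h.gaussMix_pos s a y).le (Finset.sum_nonneg fun u _ =>
    mul_nonneg (h.weight_pos u).le (klFun_nonneg ?_))
  exact div_nonneg (h.gaussMix_cond_nonneg s u a y) (h.gaussMix_pos s a y).le

/-- The weights `c u i - w i` sum to zero, so the kernel at a reference center r may be subtracted
from each kernel before Cauchy–Schwarz. With e, f the root densities, e² - f² = (e - f)(e + f), and
(e + f)² ≤ 2(e² + f²) is controlled by the mixture because `w i` and `w r` are positive. -/
theorem sq_gaussMix_sub_le (h : IsBinaryMixture q c w) (s : ℝ) (u : Bool) (r : ι)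
    (a : ι → EuclideanSpace ℝ (Fin N)) (y : EuclideanSpace ℝ (Fin N)) :
    (gaussMix s (c u) a y - gaussMix s w a y) ^ 2 ≤
      (∑ i, (∑ j, (c u j - w j) ^ 2) * (2 * (1 / w i + 1 / w r)) *
        (gauss (2 * s) (a i) y - gauss (2 * s) (a r) y) ^ 2) * gaussMix s w a y := by
  have e1 : gaussMix s (c u) a y - gaussMix s w a y =
      ∑ i, (c u i - w i) * (gauss s (a i) y - gauss s (a r) y) := by
    simp_rw [mul_sub, Finset.sum_sub_distrib, ← Finset.sum_mul, Finset.sum_sub_distrib,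
      h.cond_sum, h.sum_eq_one, sub_self, zero_mul, sub_zero, sub_mul, Finset.sum_sub_distrib]
    rfl
  have hle : ∀ i, gauss s (a i) y ≤ 1 / w i * gaussMix s w a y := by
    intro i
    rw [one_div, inv_mul_eq_div, le_div_iff₀ (h.pos i), mul_comm]
    exact Finset.single_le_sum (f := fun i => w i * gauss s (a i) y)
      (fun j _ => mul_nonneg (h.pos j).le (gauss_pos _ _ _).le) (Finset.mem_univ i)
  rw [e1]
  refine (Finset.sum_mul_sq_le_sq_mul_sq _ _ _).trans ?_
  rw [Finset.mul_sum, Finset.sum_mul]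
  refine Finset.sum_le_sum fun i _ => ?_
  have hS : 0 ≤ ∑ j, (c u j - w j) ^ 2 := Finset.sum_nonneg fun j _ => sq_nonneg _
  rw [mul_assoc, mul_assoc]
  refine mul_le_mul_of_nonneg_left ?_ hS
  have h1 := hle i
  have h2 := hle r
  rw [gauss_eq_sq] at h1 h2
  rw [gauss_eq_sq (a i), gauss_eq_sq (a r)]
  generalize gauss (2 * s) (a i) y = e at *
  generalize gauss (2 * s) (a r) y = f at *
  calc (e ^ 2 - f ^ 2) ^ 2 = (e - f) ^ 2 * (e + f) ^ 2 := by ring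
    _ ≤ (e - f) ^ 2 * (2 * ((1 / w i + 1 / w r) * gaussMix s w a y)) := by
      refine mul_le_mul_of_nonneg_left ?_ (sq_nonneg _)
      nlinarith [sq_nonneg (e - f)]
    _ = _ := by ring

/-- The information density is bounded by a combination of squared Hellinger distances between the
components, uniformly in the centers. -/
theorem exists_infoDensity_le (h : IsBinaryMixture q c w) (r : ι) :
    ∃ K : ι → ℝ, (∀ i, 0 ≤ K i) ∧ ∀ (s : ℝ) (a : ι → EuclideanSpace ℝ (Fin N)) y,
      infoDensity s q c w a y ≤
        ∑ i, K i * (gauss (2 * s) (a i) y - gauss (2 * s) (a r) y) ^ 2 := by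
  refine ⟨fun i => ∑ u, q u * ((∑ j, (c u j - w j) ^ 2) * (2 * (1 / w i + 1 / w r))),
    fun i => ?_, fun s a y => ?_⟩
  · have := (h.pos i).le
    have := (h.pos r).le
    exact Finset.sum_nonneg fun u _ => mul_nonneg (h.weight_pos u).le (by positivity)
  · rw [h.infoDensity_eq, Finset.mul_sum]
    simp_rw [Finset.sum_mul]
    rw [Finset.sum_comm]
    refine Finset.sum_le_sum fun u _ => ?_
    have hM := h.gaussMix_pos s a y
    have h1 := klFun_le_sq (div_nonneg (h.gaussMix_cond_nonneg s u a y) hM.le)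
    have h2 := h.sq_gaussMix_sub_le s u r a y
    simp_rw [mul_assoc (q u), ← Finset.mul_sum, ← Finset.sum_mul]
    rw [mul_left_comm]
    refine mul_le_mul_of_nonneg_left ?_ (h.weight_pos u).le
    refine (mul_le_mul_of_nonneg_left h1 hM.le).trans ?_
    rw [← div_le_iff₀ hM] at h2
    refine le_trans (le_of_eq ?_) h2
    field_simp

theorem integrable_gaussMix {s : ℝ} (hs : 0 < s) (w : ι → ℝ)
    (a : ι → EuclideanSpace ℝ (Fin N)) : Integrable (gaussMix s w a) :=
  integrable_finsetSum _ fun i _ => (integrable_gauss hs (a i)).const_mul (w i)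

theorem continuous_gaussMix (s : ℝ) (w : ι → ℝ) :
    Continuous fun z : (ι → EuclideanSpace ℝ (Fin N)) × EuclideanSpace ℝ (Fin N) =>
      gaussMix s w z.1 z.2 := by
  unfold gaussMix gauss
  fun_prop

theorem measurable_mul_log (s : ℝ) (v w : ι → ℝ) :
    Measurable fun z : (ι → EuclideanSpace ℝ (Fin N)) × EuclideanSpace ℝ (Fin N) =>
      gaussMix s v z.1 z.2 * Real.log (gaussMix s v z.1 z.2 / gaussMix s w z.1 z.2) :=
  (continuous_gaussMix s v).measurable.mul (Real.measurable_log.comp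
    ((continuous_gaussMix s v).measurable.div (continuous_gaussMix s w).measurable))

theorem measurable_infoDensity (s : ℝ) (q : Bool → ℝ) (c : Bool → ι → ℝ) (w : ι → ℝ) :
    Measurable fun z : (ι → EuclideanSpace ℝ (Fin N)) × EuclideanSpace ℝ (Fin N) =>
      infoDensity s q c w z.1 z.2 :=
  Finset.measurable_fun_sum _ fun u _ => (measurable_mul_log s (c u) w).const_mul (q u)

theorem integrable_mul_log (h : IsBinaryMixture q c w) {s : ℝ} (hs : 0 < s) (u : Bool)
    (a : ι → EuclideanSpace ℝ (Fin N)) :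
    Integrable fun y =>
      gaussMix s (c u) a y * Real.log (gaussMix s (c u) a y / gaussMix s w a y) := by
  refine ((integrable_gaussMix hs w a).const_mul (1 + (1 / q u) ^ 2)).mono'
    ((measurable_mul_log s (c u) w).comp measurable_prodMk_left).aestronglyMeasurable
    (Eventually.of_forall fun y => ?_)
  have hM := h.gaussMix_pos s a y
  have hA := h.gaussMix_cond_nonneg s u a y
  have hAM : q u * gaussMix s (c u) a y ≤ gaussMix s w a y := by
    rw [gaussMix, gaussMix, Finset.mul_sum]
    refine Finset.sum_le_sum fun i _ => ?_
    rw [← mul_assoc]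
    exact mul_le_mul_of_nonneg_right (h.mul_cond_le u i) (gauss_pos _ _ _).le
  have hq := h.weight_pos u
  generalize gaussMix s w a y = M at *
  generalize gaussMix s (c u) a y = A at *
  set x := A / M with hx
  -- The likelihood ratio x is at most 1 / q u, so |x log x| ≤ 1 + x² is bounded and the integrand
  -- is dominated by a multiple of the mixture.
  have hx0 : 0 ≤ x := div_nonneg hA hM.le
  have hx1 : x ≤ 1 / q u := by
    rw [hx, div_le_div_iff₀ hM hq]; linarith
  have hlog : |x * Real.log x| ≤ 1 + x ^ 2 := by
    have h1 := klFun_nonneg hx0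
    have h2 := klFun_le_sq hx0
    rw [klFun] at h1 h2
    rw [abs_le]
    constructor <;> nlinarith
  have hAx : A = M * x := by rw [hx]; field_simp
  rw [hAx, mul_assoc, Real.norm_eq_abs, abs_mul, abs_of_pos hM, mul_comm]
  refine mul_le_mul_of_nonneg_right (hlog.trans ?_) hM.le
  gcongr

theorem integral_infoDensity (h : IsBinaryMixture q c w) {s : ℝ} (hs : 0 < s)
    (a : ι → EuclideanSpace ℝ (Fin N)) :
    ∫ y, infoDensity s q c w a y = ∑ u, q u * ∫ y,
      gaussMix s (c u) a y * Real.log (gaussMix s (c u) a y / gaussMix s w a y) := by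
  simp only [infoDensity]
  rw [integral_finsetSum _ fun u _ => (h.integrable_mul_log hs u a).const_mul (q u)]
  simp_rw [integral_const_mul]

/-- The constants do not depend on the centers. Scaling the centers by ε thus gives exactly ε² times
a quadratic function of them, as needed for the average over the fading. -/
theorem exists_integral_infoDensity_le (h : IsBinaryMixture q c w) (r : ι) {s : ℝ} (hs : 0 < s) :
    ∃ K : ι → ℝ, ∀ a : ι → EuclideanSpace ℝ (Fin N),
      ∫ y, infoDensity s q c w a y ≤ ∑ i, K i * ‖a i - a r‖ ^ 2 := by
  obtain ⟨K, hK0, hK⟩ := h.exists_infoDensity_le (N := N) r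
  refine ⟨fun i => K i * ((∫ y, gauss s (0 : EuclideanSpace ℝ (Fin N)) y) / (2 * s)),
    fun a => ?_⟩
  have hi : ∀ i ∈ Finset.univ, Integrable fun y =>
      K i * (gauss (2 * s) (a i) y - gauss (2 * s) (a r) y) ^ 2 := fun i _ =>
    (integrable_sq_gauss_sub hs _ _).const_mul _
  refine (integral_mono_of_nonneg (Eventually.of_forall fun y => h.infoDensity_nonneg s a y)
    (integrable_finsetSum _ hi) (Eventually.of_forall fun y => hK s a y)).trans ?_
  rw [integral_finsetSum _ hi]
  refine Finset.sum_le_sum fun i _ => ?_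
  rw [integral_const_mul, mul_assoc]
  exact mul_le_mul_of_nonneg_left (integral_sq_gauss_sub_le hs _ _) (hK0 i)

theorem hasDerivAt_gaussMix (s : ℝ) (v : ι → ℝ) (a : ι → EuclideanSpace ℝ (Fin N))
    (y : EuclideanSpace ℝ (Fin N)) :
    HasDerivAt (fun ε : ℝ => gaussMix s v (ε • a) y)
      (gauss s 0 y * (2 / s * inner ℝ y (∑ i, v i • a i))) 0 := by
  refine (HasDerivAt.fun_sum fun i _ => (hasDerivAt_gauss_smul s (a i) y).const_mul
    (v i)).congr_deriv ?_
  simp_rw [inner_sum, inner_smul_right, Finset.mul_sum]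
  exact Finset.sum_congr rfl fun i _ => by ring

theorem gaussMix_zero (s : ℝ) {v : ι → ℝ} (hv : ∑ i, v i = 1) (y : EuclideanSpace ℝ (Fin N)) :
    gaussMix s v 0 y = gauss s 0 y := by
  simp [gaussMix, ← Finset.sum_mul, hv]

theorem tendsto_infoDensity (h : IsBinaryMixture q c w) (s : ℝ)
    (a : ι → EuclideanSpace ℝ (Fin N)) (y : EuclideanSpace ℝ (Fin N)) :
    Tendsto (fun ε : ℝ => infoDensity s q c w (ε • a) y / ε ^ 2) (𝓝[>] 0)
      (𝓝 (gauss s 0 y * (2 / s ^ 2 * inner ℝ y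
        (∑ i, (√(q false * q true) * (c false i - c true i)) • a i) ^ 2))) := by
  have hg := (gauss_pos s 0 y).ne'
  have hr : ∀ u, HasDerivAt (fun ε : ℝ => gaussMix s (c u) (ε • a) y / gaussMix s w (ε • a) y)
      (2 / s * (inner ℝ y (∑ i, c u i • a i) - inner ℝ y (∑ i, w i • a i))) 0 := by
    intro u
    have hM : gaussMix s w ((0 : ℝ) • a) y ≠ 0 := (h.gaussMix_pos s _ y).ne'
    refine ((hasDerivAt_gaussMix s (c u) a y).div (hasDerivAt_gaussMix s w a y) hM).congr_deriv ?_
    rw [zero_smul, gaussMix_zero s (h.cond_sum u), gaussMix_zero s h.sum_eq_one]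
    field_simp
  have hM : Tendsto (fun ε : ℝ => gaussMix s w (ε • a) y) (𝓝[>] 0) (𝓝 (gauss s 0 y)) := by
    have := (hasDerivAt_gaussMix s w a y).continuousAt.tendsto
    rw [zero_smul, gaussMix_zero s h.sum_eq_one] at this
    exact this.mono_left nhdsWithin_le_nhds
  have hk := fun u => tendsto_klFun_div_sq (hr u) (by
    rw [zero_smul, gaussMix_zero s (h.cond_sum u), gaussMix_zero s h.sum_eq_one, div_self hg])
  have := hM.mul (tendsto_finsetSum Finset.univ fun u _ => (hk u).const_mul (q u))
  -- Variance of a two-valued variable: if μ = q₀μ₀ + q₁μ₁ with q₀ + q₁ = 1, then q₀(μ₀ - μ)² +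
  -- q₁(μ₁ - μ)² = q₀q₁(μ₀ - μ₁)².
  have hlim : (∑ u, q u * ((2 / s * (inner ℝ y (∑ i, c u i • a i) -
      inner ℝ y (∑ i, w i • a i))) ^ 2 / 2)) = 2 / s ^ 2 * inner ℝ y
        (∑ i, (√(q false * q true) * (c false i - c true i)) • a i) ^ 2 := by
    have hw : inner ℝ y (∑ i, w i • a i) = q true * inner ℝ y (∑ i, c true i • a i) +
        q false * inner ℝ y (∑ i, c false i • a i) := by
      simp_rw [h.eq_sum, Fintype.sum_bool, inner_sum, inner_smul_right, Finset.mul_sum,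
        ← Finset.sum_add_distrib]
      exact Finset.sum_congr rfl fun i _ => by ring
    have hv : inner ℝ y (∑ i, (√(q false * q true) * (c false i - c true i)) • a i) =
        √(q false * q true) * (inner ℝ y (∑ i, c false i • a i) -
          inner ℝ y (∑ i, c true i • a i)) := by
      simp_rw [inner_sum, inner_smul_right, ← Finset.sum_sub_distrib, Finset.mul_sum]
      exact Finset.sum_congr rfl fun i _ => by ring
    have hq := h.weight_sum
    rw [hv, hw, mul_pow, Real.sq_sqrt (mul_pos (h.weight_pos _) (h.weight_pos _)).le]
    rw [Fintype.sum_bool] at hq ⊢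
    have hq' : q true = 1 - q false := by linarith
    rw [hq']
    ring
  rw [hlim] at this
  refine this.congr fun ε => ?_
  rw [h.infoDensity_eq, mul_div_assoc, Finset.sum_div]
  simp_rw [mul_div_assoc]

theorem tendsto_integral_infoDensity (h : IsBinaryMixture q c w) (r : ι) {s : ℝ} (hs : 0 < s)
    (a : ι → EuclideanSpace ℝ (Fin N)) :
    Tendsto (fun ε : ℝ => (∫ y, infoDensity s q c w (ε • a) y) / ε ^ 2) (𝓝[>] 0)
      (𝓝 (∫ y, gauss s 0 y * (2 / s ^ 2 * inner ℝ y
        (∑ i, (√(q false * q true) * (c false i - c true i)) • a i) ^ 2))) := by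
  obtain ⟨K, hK0, hK⟩ := h.exists_infoDensity_le (N := N) r
  choose C hC using fun i => exists_bound_sq_gauss_smul_sub hs (a i) (a r)
  simp_rw [← integral_div]
  refine tendsto_integral_filter_of_dominated_convergence
    (fun y => ∑ i, K i * (C i * gauss (4 * s) 0 y)) ?_ ?_ ?_ ?_
  · exact Eventually.of_forall fun ε => (((measurable_infoDensity s q c w).comp
      measurable_prodMk_left).div_const _).aestronglyMeasurable
  · filter_upwards [Ioc_mem_nhdsGT (zero_lt_one (α := ℝ))] with ε hε
    refine Eventually.of_forall fun y => ?_
    rw [Real.norm_of_nonneg (div_nonneg (h.infoDensity_nonneg _ _ _) (sq_nonneg _))]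
    refine (div_le_div_of_nonneg_right (hK s _ y) (sq_nonneg _)).trans ?_
    rw [Finset.sum_div]
    refine Finset.sum_le_sum fun i _ => ?_
    rw [mul_div_assoc]
    exact mul_le_mul_of_nonneg_left (hC i ε hε.1 hε.2 y) (hK0 i)
  · exact integrable_finsetSum _ fun i _ =>
      ((integrable_gauss_zero (by positivity)).const_mul _).const_mul _
  · exact Eventually.of_forall fun y => h.tendsto_infoDensity s a y

end IsBinaryMixture
end BICM

/-! ### Averaging over the fading and the slope in SNR -/

namespace BICM
open Filter Topology

theorem isBinaryMixture_symbolProb {m : ℕ} {b : Fin m → ℝ} (hb : ∀ k, 0 < b k ∧ b k < 1)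
    (k : Fin m) : IsBinaryMixture (bitProb b k) (condSymbolProb b k) (symbolProb b) where
  weight_pos := bitProb_pos hb k
  weight_sum := by simp [bitProb]
  cond_nonneg := condSymbolProb_nonneg hb k
  cond_sum := sum_condSymbolProb hb k
  eq_sum := symbolProb_eq_sum_condSymbolProb hb k
  pos := symbolProb_pos hb

variable {m N : ℕ}

/-- The normalizing constant of the Gaussian density. -/
noncomputable def gaussConst (N : ℕ) (N₀ : ℝ) : ℝ := 1 / (N₀ * Real.pi) ^ ((N : ℝ) / 2)

theorem gaussConst_pos (N : ℕ) {N₀ : ℝ} (hN₀ : 0 < N₀) : 0 < gaussConst N N₀ := by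
  have := Real.pi_pos
  unfold gaussConst
  positivity

theorem outputDensity_eq (N₀ : ℝ) (b : Fin m → ℝ) (X : Fin (2 ^ m) → EuclideanSpace ℝ (Fin N))
    (h y : EuclideanSpace ℝ (Fin N)) :
    outputDensity N₀ b X h y =
      gaussConst N N₀ * gaussMix N₀ (symbolProb b) (fun i => hadamardProd h (X i)) y := by
  rw [outputDensity, gaussMix, Finset.mul_sum]
  exact Finset.sum_congr rfl fun i _ => mul_left_comm _ _ _

theorem condOutputDensity_eq (N₀ : ℝ) (b : Fin m → ℝ)
    (X : Fin (2 ^ m) → EuclideanSpace ℝ (Fin N)) (k : Fin m) (u : Bool)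
    (h y : EuclideanSpace ℝ (Fin N)) :
    condOutputDensity N₀ b X k u h y =
      gaussConst N N₀ * gaussMix N₀ (condSymbolProb b k u) (fun i => hadamardProd h (X i)) y := by
  rw [condOutputDensity, gaussMix, Finset.mul_sum]
  exact Finset.sum_congr rfl fun i _ => mul_left_comm _ _ _

/-- The Gaussian normalization cancels inside the logarithm and survives only as an outer factor;
log 2 converts nats to bits. -/
theorem bitMutualInfo_eq {b : Fin m → ℝ} (hb : ∀ k, 0 < b k ∧ b k < 1)
    (ν : Measure (EuclideanSpace ℝ (Fin N))) {N₀ : ℝ} (hN₀ : 0 < N₀)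
    (X : Fin (2 ^ m) → EuclideanSpace ℝ (Fin N)) (k : Fin m) :
    bitMutualInfo ν N₀ b X k = gaussConst N N₀ / Real.log 2 *
      ∫ h, (∫ y, infoDensity N₀ (bitProb b k) (condSymbolProb b k) (symbolProb b)
        (fun i => hadamardProd h (X i)) y) ∂ν := by
  rw [bitMutualInfo, ← integral_const_mul]
  refine integral_congr_ae (Eventually.of_forall fun h => ?_)
  beta_reduce
  rw [(isBinaryMixture_symbolProb hb k).integral_infoDensity hN₀, Finset.mul_sum]
  refine Finset.sum_congr rfl fun u _ => ?_
  rw [mul_left_comm]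
  refine congrArg (bitProb b k u * ·) ?_
  rw [← integral_const_mul]
  refine integral_congr_ae (Eventually.of_forall fun y => ?_)
  beta_reduce
  rw [outputDensity_eq, condOutputDensity_eq, mul_div_mul_left _ _ (gaussConst_pos N hN₀).ne',
    Real.logb]
  ring

theorem hadamardProd_smul (h x : EuclideanSpace ℝ (Fin N)) (t : ℝ) :
    hadamardProd h (t • x) = t • hadamardProd h x := by
  ext n
  simp [hadamardProd]
  ring

theorem hadamardProd_sub (h x y : EuclideanSpace ℝ (Fin N)) :
    hadamardProd h (x - y) = hadamardProd h x - hadamardProd h y := by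
  ext n
  simp [hadamardProd]
  ring

theorem hadamardProd_sum_smul {ι : Type*} [Fintype ι] (h : EuclideanSpace ℝ (Fin N)) (v : ι → ℝ)
    (X : ι → EuclideanSpace ℝ (Fin N)) :
    hadamardProd h (∑ i, v i • X i) = ∑ i, v i • hadamardProd h (X i) := by
  ext n
  simp [hadamardProd, Finset.mul_sum]
  exact Finset.sum_congr rfl fun i _ => by ring

theorem continuous_hadamardProd (x : EuclideanSpace ℝ (Fin N)) :
    Continuous fun h => hadamardProd h x := by
  unfold hadamardProd
  fun_prop

theorem integrable_norm_hadamardProd_sq (ν : Measure (EuclideanSpace ℝ (Fin N)))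
    (hν : ∀ n, Integrable (fun h : EuclideanSpace ℝ (Fin N) => h n ^ 2) ν)
    (x : EuclideanSpace ℝ (Fin N)) : Integrable (fun h => ‖hadamardProd h x‖ ^ 2) ν := by
  simp_rw [EuclideanSpace.norm_sq_eq, hadamardProd, norm_mul, mul_pow, Real.norm_eq_abs, sq_abs]
  exact integrable_finsetSum _ fun n _ => (hν n).mul_const _

theorem measurable_integral_infoDensity_hadamardProd {ι : Type*} [Fintype ι] (s : ℝ)
    (q : Bool → ℝ) (c : Bool → ι → ℝ) (w : ι → ℝ) (X : ι → EuclideanSpace ℝ (Fin N)) (ε : ℝ) :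
    Measurable fun h : EuclideanSpace ℝ (Fin N) =>
      ∫ y, infoDensity s q c w (fun i => ε • hadamardProd h (X i)) y := by
  have hp : Measurable fun z : EuclideanSpace ℝ (Fin N) × EuclideanSpace ℝ (Fin N) =>
      ((fun i => ε • hadamardProd z.1 (X i)), z.2) := by
    refine Measurable.prodMk (measurable_pi_lambda _ fun i => ?_) measurable_snd
    exact (((continuous_hadamardProd (X i)).comp continuous_fst).const_smul ε).measurable
  have hm := (IsBinaryMixture.measurable_infoDensity s q c w).comp hp
  exact (hm.stronglyMeasurable.integral_prod_right' (ν := volume)).measurable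

/-- The low-energy slope of the mutual information of a bit with scaled mean difference `v`. -/
noncomputable def bitSlope (ν : Measure (EuclideanSpace ℝ (Fin N))) (N₀ : ℝ)
    (v : EuclideanSpace ℝ (Fin N)) : ℝ :=
  gaussConst N N₀ / Real.log 2 *
    ∫ h, (∫ y, gauss N₀ 0 y * (2 / N₀ ^ 2 * inner ℝ y (hadamardProd h v) ^ 2)) ∂ν

/-- Dominated convergence in h. The pointwise majorants used in y grow exponentially in the squared
norms of the centers and need not be integrable in h; the Hellinger bound is quadratic in h, hence
integrable by the second-moment hypothesis. -/
theorem tendsto_bitMutualInfo {b : Fin m → ℝ} (hb : ∀ k, 0 < b k ∧ b k < 1)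
    (ν : Measure (EuclideanSpace ℝ (Fin N)))
    (hν : ∀ n, Integrable (fun h : EuclideanSpace ℝ (Fin N) => h n ^ 2) ν) {N₀ : ℝ}
    (hN₀ : 0 < N₀) (X : Fin (2 ^ m) → EuclideanSpace ℝ (Fin N)) (k : Fin m) :
    Tendsto (fun ε : ℝ => bitMutualInfo ν N₀ b (fun i => ε • X i) k / ε ^ 2) (𝓝[>] 0)
      (𝓝 (bitSlope ν N₀ (bitContrast b X k))) := by
  have hM := isBinaryMixture_symbolProb hb k
  -- Any symbol can serve as the reference center.
  let r : Fin (2 ^ m) := ⟨0, by positivity⟩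
  obtain ⟨K, hK⟩ := hM.exists_integral_infoDensity_le (N := N) r hN₀
  simp_rw [bitMutualInfo_eq hb ν hN₀, mul_div_assoc, bitSlope, hadamardProd_smul]
  refine Tendsto.const_mul _ (Tendsto.congr (fun ε => integral_div (ε ^ 2) _) ?_)
  refine tendsto_integral_filter_of_dominated_convergence
    (fun h => ∑ i, K i * ‖hadamardProd h (X i - X r)‖ ^ 2) ?_ ?_ ?_ ?_
  · exact Eventually.of_forall fun ε => ((measurable_integral_infoDensity_hadamardProd N₀ _ _ _ X
      ε).div_const _).aestronglyMeasurable
  · filter_upwards [self_mem_nhdsWithin] with ε (hε : 0 < ε)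
    refine Eventually.of_forall fun h => ?_
    rw [Real.norm_of_nonneg (div_nonneg
      (integral_nonneg fun y => hM.infoDensity_nonneg _ _ _) (sq_nonneg _)),
      div_le_iff₀ (by positivity)]
    refine (hK _).trans_eq ?_
    rw [Finset.sum_mul]
    refine Finset.sum_congr rfl fun i _ => ?_
    rw [← smul_sub, norm_smul, hadamardProd_sub, mul_pow, Real.norm_of_nonneg hε.le]
    ring
  · exact integrable_finsetSum _ fun i _ =>
      (integrable_norm_hadamardProd_sq ν hν _).const_mul _
  · refine Eventually.of_forall fun h => ?_
    have := hM.tendsto_integral_infoDensity r hN₀ fun i => hadamardProd h (X i)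
    rwa [← hadamardProd_sum_smul] at this

theorem bitMutualInfo_zero {b : Fin m → ℝ} (hb : ∀ k, 0 < b k ∧ b k < 1)
    (ν : Measure (EuclideanSpace ℝ (Fin N))) {N₀ : ℝ} (hN₀ : 0 < N₀) (k : Fin m) :
    bitMutualInfo ν N₀ b (fun _ => 0) k = 0 := by
  have hM := isBinaryMixture_symbolProb hb k
  have h0 : ∀ h : EuclideanSpace ℝ (Fin N), (fun _ : Fin (2 ^ m) => hadamardProd h 0) = 0 := by
    intro h
    funext i
    ext n
    simp [hadamardProd]
  rw [bitMutualInfo_eq hb ν hN₀]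
  simp_rw [h0, hM.infoDensity_eq, IsBinaryMixture.gaussMix_zero N₀ (hM.cond_sum _),
    IsBinaryMixture.gaussMix_zero N₀ hM.sum_eq_one, div_self (gauss_pos _ _ _).ne',
    InformationTheory.klFun_one]
  simp

/-- The scale factor is ε = √(s / SNR₀), with SNR₀ the SNR of the unscaled alphabet, so the
difference quotient in s is the quotient by ε² divided by SNR₀. -/
theorem hasDerivWithinAt_gmiAtSNR {b : Fin m → ℝ} (hb : ∀ k, 0 < b k ∧ b k < 1)
    (ν : Measure (EuclideanSpace ℝ (Fin N)))
    (hν : ∀ n, Integrable (fun h : EuclideanSpace ℝ (Fin N) => h n ^ 2) ν) (ρ : Measure ℝ)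
    {N₀ : ℝ} (hN₀ : 0 < N₀) (X : Fin (2 ^ m) → EuclideanSpace ℝ (Fin N))
    (hS : 0 ≤ snr ρ N₀ b X) :
    HasDerivWithinAt (gmiAtSNR ν ρ N₀ b X)
      ((∑ k, bitSlope ν N₀ (bitContrast b X k)) / snr ρ N₀ b X) (Set.Ici 0) 0 := by
  rcases hS.eq_or_lt with h0 | hS
  -- When SNR₀ = 0, division by zero makes the scale factor 0, so the function is constant; the
  -- claimed slope is likewise 0.
  · have : gmiAtSNR ν ρ N₀ b X = fun _ => gmi ν N₀ b fun _ => 0 := by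
      funext s
      simp [gmiAtSNR, ← h0]
    rw [this, ← h0, div_zero]
    exact hasDerivWithinAt_const _ _ _
  · have hz : gmiAtSNR ν ρ N₀ b X 0 = 0 := by
      simp [gmiAtSNR, gmi, bitMutualInfo_zero hb ν hN₀]
    have hsqrt : Tendsto (fun s => √(s / snr ρ N₀ b X)) (𝓝[>] 0) (𝓝[>] 0) := by
      refine tendsto_nhdsWithin_iff.2 ⟨?_, ?_⟩
      · have hc : Continuous fun s => √(s / snr ρ N₀ b X) := by fun_prop
        have := hc.tendsto 0
        rw [zero_div, Real.sqrt_zero] at this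
        exact this.mono_left nhdsWithin_le_nhds
      · filter_upwards [self_mem_nhdsWithin] with s (hs : 0 < s)
        exact Real.sqrt_pos.2 (div_pos hs hS)
    rw [hasDerivWithinAt_iff_tendsto_slope, Set.Ici_sdiff_left]
    have h := ((tendsto_finsetSum Finset.univ fun k _ =>
      tendsto_bitMutualInfo hb ν hν hN₀ X k).comp hsqrt).div_const (snr ρ N₀ b X)
    refine h.congr' ?_
    filter_upwards [self_mem_nhdsWithin] with s (hs : 0 < s)
    rw [slope_def_field, hz, sub_zero, sub_zero, gmiAtSNR, gmi, Function.comp_apply,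
      ← Finset.sum_div, div_div, Real.sq_sqrt (div_pos hs hS).le, div_mul_cancel₀ s hS.ne']

theorem secondMoment_nonneg (ρ : Measure ℝ) : 0 ≤ secondMoment ρ :=
  integral_nonneg fun t => sq_nonneg t

theorem snr_nonneg (ρ : Measure ℝ) {N₀ : ℝ} (hN₀ : 0 < N₀) {b : Fin m → ℝ}
    (hb : ∀ k, 0 < b k ∧ b k < 1) (X : Fin (2 ^ m) → EuclideanSpace ℝ (Fin N)) :
    0 ≤ snr ρ N₀ b X := by
  refine div_nonneg (mul_nonneg (secondMoment_nonneg ρ) ?_) hN₀.le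
  exact Finset.sum_nonneg fun i _ => mul_nonneg (symbolProb_pos hb i).le (sq_nonneg _)

end BICM

theorem theorem6 {m N : ℕ}
    (b : Fin m → ℝ) (hb : ∀ k, 0 < b k ∧ b k < 1)
    (X : Fin (2 ^ m) → EuclideanSpace ℝ (Fin N))
    (ν : Measure (EuclideanSpace ℝ (Fin N))) [IsProbabilityMeasure ν]
    (ρ : Measure ℝ) [IsProbabilityMeasure ρ]
    (hmarginal : ∀ n : Fin N, ν.map (fun h => h n) = ρ)
    (hint : Integrable (fun t : ℝ => t ^ 2) ρ) (hpos : 0 < BICM.secondMoment ρ)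
    (N₀ : ℝ) (hN₀ : 0 < N₀) :
    DifferentiableWithinAt ℝ (BICM.gmiAtSNR ν ρ N₀ b X) (Set.Ici 0) 0 ∧
    DifferentiableWithinAt ℝ
      (BICM.gmiAtSNR ν ρ N₀ (BICM.uniformBits m) (BICM.newTransform b X)) (Set.Ici 0) 0 ∧
    BICM.lowGMIParameters ν ρ N₀ b X =
      BICM.lowGMIParameters ν ρ N₀ (BICM.uniformBits m) (BICM.newTransform b X) := by
  -- Only the second moment of each fading component matters, and it is determined by the common
  -- marginal; dependence between components plays no role.
  have hν : ∀ n, Integrable (fun h : EuclideanSpace ℝ (Fin N) => h n ^ 2) ν := by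
    intro n
    have h := hint
    rw [← hmarginal n] at h
    exact h.comp_measurable (by fun_prop)
  have h1 := BICM.hasDerivWithinAt_gmiAtSNR hb ν hν ρ hN₀ X (BICM.snr_nonneg ρ hN₀ hb X)
  have h2 := BICM.hasDerivWithinAt_gmiAtSNR BICM.uniformBits_mem ν hν ρ hN₀ (BICM.newTransform b X)
    (BICM.snr_nonneg ρ hN₀ BICM.uniformBits_mem _)
  have hu : UniqueDiffWithinAt ℝ (Set.Ici (0 : ℝ)) 0 := uniqueDiffOn_Ici 0 0 Set.self_mem_Ici
  refine ⟨h1.differentiableWithinAt, h2.differentiableWithinAt, ?_⟩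
  rw [BICM.lowGMIParameters, BICM.lowGMIParameters, BICM.mean_newTransform hb,
    BICM.energy_newTransform hb, BICM.alpha, BICM.alpha, h1.derivWithin hu, h2.derivWithin hu]
  simp_rw [BICM.bitContrast_newTransform hb, BICM.snr, BICM.energy_newTransform hb]
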